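/- A weight is a measurable function $w:(0,\infty)\to[0,\infty)$ that is locally integrable on $[0,\infty)$; put $W(t)=\int_0^t w(s)\,ds$. "Decreasing" means nonincreasing. For a measurable function $f\ge 0$ on a measure space $(X,\mu)$ let $f^*_\mu(t)=\inf\{\lambda\ge 0:\mu(\{f>\lambda\})\le t\}$ be its decreasing rearrangement. For measurable $f:\mathbb R^n\to[0,\infty)$ (with $n\ge1$ and Lebesgue measure) write $f^*$ for its rearrangement, and let $f^{**}=S(f^*)$, where $S$ is the Hardy operator $Sg(t)=\frac1t\int_0^t g(s)\,ds$, $t>0$. For $1<q<\infty$ set $$\|f\|_{\Lambda^1(w)}=\int_0^\infty f^*(t)\,w(t)\,dt,\qquad \|f\|_{\Gamma^{1,q}(w)}=\Big(\int_0^\infty f^{**}(t)^q\,W(t)^{q-1}w(t)\,dt\Big)^{1/q},$$ and let $\Lambda^1(w)$, $\Gamma^{1,q}(w)$ be the sets of measurable $f:\mathbb R^n\to[0,\infty)$ for which the corresponding quantity is finite. Let $L^1(w)$ and $L^{1,q}(w)$ be the Lebesgue and Lorentz spaces on $(0,\infty)$ with respect to the measure $w(t)\,dt$, where $\|g\|_{L^{1,q}(w)}=\big(\int_0^\infty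 (t\,g_w^*(t))^q\,\frac{dt}{t}\big)^{1/q}$ and $g_w^*$ is the rearrangement of $g\ge0$ with respect to $w(t)\,dt$. Let $L^1_{\rm dec}(w)$ be the cone of decreasing functions $g:(0,\infty)\to[0,\infty)$ in $L^1(w)$. Theorem. Let $n\ge 1$, let $w$ be a decreasing weight and let $1<q<\infty$. The following are equivalent: (i) $\Lambda^1(w)\subset\Gamma^{1,q}(w)$; (i$'$) there is $C<\infty$ with $\|f\|_{\Gamma^{1,q}(w)}\le C\|f\|_{\Lambda^1(w)}$ for all $f\in\Lambda^1(w)$; (ii) $Sg\in L^{1,q}(w)$ for every $g\in L^1_{\rm dec}(w)$; (ii$'$) there is $C<\infty$ with $\|Sg\|_{L^{1,q}(w)}\le C\|g\|_{L^1(w)}$ for all $g\in L^1_{\rm dec}(w)$; (iii) $w\in B_1$, i.e. there is $C<\infty$ with $\int_r^\infty \frac{w(s)}{s}\,ds\le \frac Cr\int_0^r w(s)\,ds$ for all $r>0$; (iv) there is $C<\infty$ with $\|Sg\|_{L^1(w)}\le C\|g\|_{L^1(w)}$ for all $g\in L^1_{\rm dec}(w)$ (the strong type $(1,1)$ Hardy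 inequality on decreasing functions). In particular, there is no Hardy inequality $L^1_{\rm dec}(w)\to L^{1,q}(w)$, $1<q<\infty$, strictly intermediate between the weak type and the strong type $(1,1)$ inequality. -/

import Mathlib

open Set MeasureTheory
open scoped NNReal ENNReal

noncomputable section

/-- A weight on `(0, ∞)`: a nonnegative measurable function, locally integrable on `[0, ∞)`.
The value at `0` plays no role. -/
structure IsWeight (w : ℝ → ℝ≥0) : Prop where
  aemeasurable : AEMeasurable w (volume.restrict (Ioi (0 : ℝ)))
  locallyIntegrable : LocallyIntegrableOn (fun t => (w t : ℝ)) (Ici (0 : ℝ)) volume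

/-- The primitive `W(t) = ∫_0^t w`. -/
def weightPrimitive (w : ℝ → ℝ≥0) (t : ℝ) : ℝ≥0∞ :=
  ∫⁻ s in Ioc 0 t, (w s : ℝ≥0∞)

/-- The measure `w(t) dt` on `(0, ∞)`. -/
def weightMeasure (w : ℝ → ℝ≥0) : Measure ℝ :=
  (volume.restrict (Ioi (0 : ℝ))).withDensity (fun t => (w t : ℝ≥0∞))

/-- The decreasing rearrangement of a nonnegative function `f` with respect to `μ`:
`f^*(t) = inf {l ≥ 0 : μ {f > l} ≤ t}`. -/
def rearrangement {α : Type*} [MeasurableSpace α] (μ : Measure α) (f : α → ℝ≥0∞) (t : ℝ) :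
    ℝ≥0∞ :=
  sInf {l : ℝ≥0∞ | μ {x | l < f x} ≤ ENNReal.ofReal t}

/-- The Hardy operator `S f (t) = t⁻¹ ∫_0^t f`. -/
def hardyOp (f : ℝ → ℝ≥0∞) (t : ℝ) : ℝ≥0∞ :=
  (∫⁻ s in Ioc 0 t, f s) / ENNReal.ofReal t

/-- `f^*` for a function on `ℝⁿ` with Lebesgue measure. -/
def fStar {n : ℕ} (f : EuclideanSpace ℝ (Fin n) → ℝ≥0) : ℝ → ℝ≥0∞ :=
  rearrangement volume (fun x => (f x : ℝ≥0∞))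

/-- The maximal function `f^{**} = S f^*`. -/
def fStarStar {n : ℕ} (f : EuclideanSpace ℝ (Fin n) → ℝ≥0) : ℝ → ℝ≥0∞ :=
  hardyOp (fStar f)

/-- `(∫_0^∞ f^*(t)^p w(t) dt)^{1/p}`. -/
def lambdaNorm {n : ℕ} (p : ℝ) (w : ℝ → ℝ≥0) (f : EuclideanSpace ℝ (Fin n) → ℝ≥0) : ℝ≥0∞ :=
  (∫⁻ t in Ioi (0 : ℝ), fStar f t ^ p * (w t : ℝ≥0∞)) ^ (1 / p)

/-- `(∫_0^∞ f^{**}(t)^q W(t)^{q/p-1} w(t) dt)^{1/q}`. -/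
def gammaNorm {n : ℕ} (p q : ℝ) (w : ℝ → ℝ≥0) (f : EuclideanSpace ℝ (Fin n) → ℝ≥0) : ℝ≥0∞ :=
  (∫⁻ t in Ioi (0 : ℝ),
    fStarStar f t ^ q * weightPrimitive w t ^ (q / p - 1) * (w t : ℝ≥0∞)) ^ (1 / q)

/-- The weighted Lorentz space `Λ^p(w)` of (Lebesgue measurable) functions `ℝⁿ → [0, ∞)`. -/
def LambdaSpace (n : ℕ) (p : ℝ) (w : ℝ → ℝ≥0) : Set (EuclideanSpace ℝ (Fin n) → ℝ≥0) :=
  {f | AEMeasurable f volume ∧ lambdaNorm p w f < ∞}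

/-- The space `Γ^{p,q}(w)` of (Lebesgue measurable) functions `ℝⁿ → [0, ∞)`. -/
def GammaSpace (n : ℕ) (p q : ℝ) (w : ℝ → ℝ≥0) : Set (EuclideanSpace ℝ (Fin n) → ℝ≥0) :=
  {f | AEMeasurable f volume ∧ gammaNorm p q w f < ∞}

/-- The norm `(∫_0^∞ g(t)^p w(t) dt)^{1/p}` of the weighted Lebesgue space `L^p(w)`. -/
def weightedLpNorm (p : ℝ) (w : ℝ → ℝ≥0) (g : ℝ → ℝ≥0∞) : ℝ≥0∞ :=
  (∫⁻ t in Ioi (0 : ℝ), g t ^ p * (w t : ℝ≥0∞)) ^ (1 / p)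

/-- The cone `L^p_dec(w)` of nonnegative decreasing functions on `(0, ∞)` in `L^p(w)`. -/
def LpDec (p : ℝ) (w : ℝ → ℝ≥0) : Set (ℝ → ℝ≥0) :=
  {f | AntitoneOn f (Ioi 0) ∧ weightedLpNorm p w (fun t => (f t : ℝ≥0∞)) < ∞}

/-- The Lorentz quasi-norm `(∫_0^∞ (t^{1/p} g^*(t))^q dt/t)^{1/q}` of the space `L^{p,q}(w)`,
where `g^*` is the rearrangement with respect to the measure `w(t) dt` on `(0, ∞)`. -/
def weightedLorentzNorm (p q : ℝ) (w : ℝ → ℝ≥0) (g : ℝ → ℝ≥0∞) : ℝ≥0∞ :=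
  (∫⁻ t in Ioi (0 : ℝ),
    (ENNReal.ofReal t ^ (1 / p) * rearrangement (weightMeasure w) g t) ^ q
      / ENNReal.ofReal t) ^ (1 / q)

/-- The space `L^{p,q}(w)` (nonnegative functions). -/
def WeightedLorentz (p q : ℝ) (w : ℝ → ℝ≥0) : Set (ℝ → ℝ≥0∞) :=
  {g | AEMeasurable g (weightMeasure w) ∧ weightedLorentzNorm p q w g < ∞}

/-- The class `B_p`: `∫_r^∞ w(s) s^{-p} ds ≤ C r^{-p} ∫_0^r w(s) ds` for all `r > 0`. -/
def BClass (p : ℝ) (w : ℝ → ℝ≥0) : Prop :=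
  ∃ C : ℝ≥0, ∀ r : ℝ, 0 < r →
    ∫⁻ s in Ioi r, (w s : ℝ≥0∞) / ENNReal.ofReal s ^ p
      ≤ (C : ℝ≥0∞) / ENNReal.ofReal r ^ p * ∫⁻ s in Ioc 0 r, (w s : ℝ≥0∞)

end

/-! Everything is compared with the `L^1(w)` norm of `Sg`. For a nonnegative `h` with `L^1(w)` norm
`I`, Chebyshev gives `t h^*(t) ≤ I`, so `(t h^*)^q / t ≤ I^(q-1) h^*` and the `L^{1,q}(w)`
functional is at most `I`. The `Γ` functional is treated in the same way, with `Sg(t) W(t) ≤ ∫ Sg w`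
for decreasing `Sg`. Hence the strong type inequality implies both norm estimates, and these imply
the inclusions.

Under `B_1`, Tonelli turns `∫ Sg w` into `∫ g v` with `v(s) = ∫_s^∞ w(t)/t dt`. The condition bounds
the integral of `v` over each `(0, r]` by a multiple of `W(r)`, and the layer cake formula extends
this to decreasing `g`, whose level sets are initial intervals (`BClass.lintegral_hardyOp_le`).

The substance is that either inclusion forces `B_1`. If `B_1` fails, `bClass_one_of_decay` yields,
for each `N ≥ 1`, some `r` with `W(4^N r) > (4^N/2) W(r)`. As `w` is decreasing, `W(t)/t` decreases,
so `W(t)` stays within a factor 2 of `t W(r)/r` on `[r, 4^N r]`. For `g = c 1_(0,r)`, with `Sg(t) =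
cr/t` for `t ≥ r`, each of the `N` blocks of ratio 4 then contributes at least `(c W(r)/8)^q` to
either functional, while the `L^1(w)` norm is only `c W(r)`. A series of such bumps with summable
norms and rapidly growing `N` is one function violating both inclusions
(`IsWeight.exists_extremal`), so no uniform boundedness argument is needed. On `ℝⁿ` it is realized
by a radial function. -/

/-! ### Layer cake formula -/

theorem volume_ofReal_lt (x : ℝ≥0∞) :
    (volume.restrict (Ioi (0 : ℝ))) {l | ENNReal.ofReal l < x} = x := by
  rw [Measure.restrict_apply (measurableSet_lt ENNReal.measurable_ofReal measurable_const)]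
  induction x with
  | top => simp
  | coe x =>
    have : {l | ENNReal.ofReal l < (x : ℝ≥0∞)} ∩ Ioi 0 = Ioo 0 (x : ℝ) := by
      ext l
      simp only [mem_inter_iff, mem_ofPred_eq, mem_Ioi, mem_Ioo]
      constructor
      · rintro ⟨h, h0⟩
        rw [← ENNReal.ofReal_coe_nnreal, ENNReal.ofReal_lt_ofReal_iff_of_nonneg h0.le] at h
        exact ⟨h0, h⟩
      · rintro ⟨h0, h⟩
        rw [← ENNReal.ofReal_coe_nnreal, ENNReal.ofReal_lt_ofReal_iff_of_nonneg h0.le]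
        exact ⟨h, h0⟩
    rw [this]
    simp

/-- Tonelli on the subgraph of `f`; the value `∞` is allowed, its vertical section having infinite
length. -/
theorem lintegral_eq_lintegral_measure_ofReal_lt {α : Type*} [MeasurableSpace α] {μ : Measure α}
    [SFinite μ] {f : α → ℝ≥0∞} (hf : AEMeasurable f μ) :
    ∫⁻ x, f x ∂μ = ∫⁻ l in Ioi (0 : ℝ), μ {x | ENNReal.ofReal l < f x} := by
  have key : ∀ g : α → ℝ≥0∞, Measurable g →
      ∫⁻ x, g x ∂μ = ∫⁻ l in Ioi (0 : ℝ), μ {x | ENNReal.ofReal l < g x} := by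
    intro g hg
    have hs : MeasurableSet {p : α × ℝ | ENNReal.ofReal p.2 < g p.1} :=
      measurableSet_lt (ENNReal.measurable_ofReal.comp measurable_snd) (hg.comp measurable_fst)
    have h1 := Measure.prod_apply (μ := μ) (ν := volume.restrict (Ioi (0 : ℝ))) hs
    have h2 := Measure.prod_apply_symm (μ := μ) (ν := volume.restrict (Ioi (0 : ℝ))) hs
    rw [h1] at h2
    simp only [preimage_ofPred_eq, volume_ofReal_lt] at h2
    exact h2
  rw [lintegral_congr_ae hf.ae_eq_mk, key _ hf.measurable_mk]
  refine lintegral_congr fun l => measure_congr ?_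
  filter_upwards [hf.ae_eq_mk] with x hx
  exact congrArg (ENNReal.ofReal l < ·) hx.symm

/-! ### Decreasing rearrangement -/

section Rearrangement

variable {α : Type*} [MeasurableSpace α] {μ : Measure α}

theorem rearrangement_antitone (f : α → ℝ≥0∞) : Antitone (rearrangement μ f) := fun _ _ h =>
  sInf_le_sInf fun _ hl => le_trans (α := ℝ≥0∞) hl (ENNReal.ofReal_le_ofReal h)

theorem rearrangement_le {f : α → ℝ≥0∞} {t : ℝ} {l : ℝ≥0∞}
    (h : μ {x | l < f x} ≤ ENNReal.ofReal t) : rearrangement μ f t ≤ l :=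
  sInf_le h

theorem le_rearrangement {f : α → ℝ≥0∞} {t : ℝ} {a : ℝ≥0∞}
    (h : ENNReal.ofReal t < μ {x | a ≤ f x}) : a ≤ rearrangement μ f t := by
  refine le_sInf fun l hl => ?_
  by_contra! hla
  exact (h.trans_le ((measure_mono fun x hx => hla.trans_le hx).trans hl)).false

theorem lt_measure_of_lt_rearrangement {f : α → ℝ≥0∞} {t : ℝ} {l : ℝ≥0∞}
    (h : l < rearrangement μ f t) : ENNReal.ofReal t < μ {x | l < f x} := by
  by_contra! hl
  exact (h.trans_le (rearrangement_le hl)).false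

/-- Chebyshev at height `(∫ f) / t`; heights `0` and `∞` are treated apart. -/
theorem rearrangement_le_lintegral_div {f : α → ℝ≥0∞} (hf : AEMeasurable f μ) {t : ℝ}
    (ht : 0 < t) : rearrangement μ f t ≤ (∫⁻ x, f x ∂μ) / ENNReal.ofReal t := by
  have ht' : ENNReal.ofReal t ≠ 0 := by simpa using ht
  rcases eq_or_ne (∫⁻ x, f x ∂μ) ∞ with hI | hI
  · rw [hI, ENNReal.top_div_of_ne_top ENNReal.ofReal_ne_top]
    exact le_top
  rcases eq_or_ne (∫⁻ x, f x ∂μ) 0 with h0 | h0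
  · refine rearrangement_le ?_
    rw [h0, ENNReal.zero_div]
    rw [lintegral_eq_zero_iff' hf] at h0
    have : μ {x | 0 < f x} = 0 :=
      measure_mono_null (fun x (hx : 0 < f x) => hx.ne') (ae_iff.1 h0)
    simp [this]
  refine rearrangement_le ?_
  have hle : μ {x | (∫⁻ x, f x ∂μ) / ENNReal.ofReal t < f x} ≤
      μ {x | (∫⁻ x, f x ∂μ) / ENNReal.ofReal t ≤ f x} :=
    measure_mono fun x (hx : _ < f x) => hx.le
  refine hle.trans ((meas_ge_le_lintegral_div hf ?_ ?_).trans ?_)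
  · exact (ENNReal.div_pos h0 ENNReal.ofReal_ne_top).ne'
  · exact ENNReal.div_ne_top hI ht'
  · rw [ENNReal.div_le_iff (ENNReal.div_pos h0 ENNReal.ofReal_ne_top).ne'
      (ENNReal.div_ne_top hI ht'), ENNReal.mul_div_cancel ht' ENNReal.ofReal_ne_top]

/-- Layer cake on both sides: `l < f^*(t)` forces `t < μ {f > l}`, and those `t` fill a set of
length `μ {f > l}`. -/
theorem lintegral_rearrangement_le [SFinite μ] {f : α → ℝ≥0∞} (hf : AEMeasurable f μ) :
    ∫⁻ t in Ioi (0 : ℝ), rearrangement μ f t ≤ ∫⁻ x, f x ∂μ := by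
  rw [lintegral_eq_lintegral_measure_ofReal_lt hf, lintegral_eq_lintegral_measure_ofReal_lt
    (rearrangement_antitone f).measurable.aemeasurable]
  refine lintegral_mono fun l => ?_
  conv_rhs => rw [← volume_ofReal_lt (μ {x | ENNReal.ofReal l < f x})]
  exact measure_mono fun t ht => lt_measure_of_lt_rearrangement ht

end Rearrangement

/-! ### The Lorentz functional is dominated by the `L^1` norm -/

theorem rpow_sub_one_mul_self {x : ℝ≥0∞} {q : ℝ} (hq : 1 < q) :
    x ^ (q - 1) * x = x ^ q := by
  rcases eq_or_ne x ∞ with rfl | hx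
  · rw [ENNReal.top_rpow_of_pos (by linarith), ENNReal.top_rpow_of_pos (by linarith)]; simp
  rcases eq_or_ne x 0 with rfl | h0
  · simp [ENNReal.zero_rpow_of_pos (show 0 < q by linarith)]
  conv_lhs => enter [2]; rw [← ENNReal.rpow_one x]
  rw [← ENNReal.rpow_add _ _ h0 hx, sub_add_cancel]

theorem rpow_le_rpow_sub_one_mul {x y : ℝ≥0∞} {q : ℝ} (hq : 1 < q) (h : x ≤ y) :
    x ^ q ≤ y ^ (q - 1) * x := by
  rw [← rpow_sub_one_mul_self hq]
  gcongr

theorem weightedLorentzNorm_le {q : ℝ} (hq : 1 < q) {w : ℝ → ℝ≥0} {h : ℝ → ℝ≥0∞}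
    (hh : AEMeasurable h (weightMeasure w)) :
    weightedLorentzNorm 1 q w h ≤ ∫⁻ t, h t ∂(weightMeasure w) := by
  have : SFinite (weightMeasure w) := by unfold weightMeasure; infer_instance
  set I := ∫⁻ t, h t ∂(weightMeasure w)
  have hq0 : 0 < q := by linarith
  rw [weightedLorentzNorm, one_div q, ENNReal.rpow_inv_le_iff hq0, ← rpow_sub_one_mul_self hq]
  refine le_trans ?_ (mul_le_mul_right (lintegral_rearrangement_le hh) _)
  rw [← lintegral_const_mul _ (rearrangement_antitone h).measurable]
  refine setLIntegral_mono' measurableSet_Ioi fun t (ht : 0 < t) => ?_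
  have ht0 : ENNReal.ofReal t ≠ 0 := by simpa using ht
  have h1 : ENNReal.ofReal t * rearrangement (weightMeasure w) h t ≤ I := by
    rw [mul_comm, ← ENNReal.le_div_iff_mul_le (Or.inl ht0) (Or.inl ENNReal.ofReal_ne_top)]
    exact rearrangement_le_lintegral_div hh ht
  rw [div_one, ENNReal.rpow_one, ENNReal.div_le_iff ht0 ENNReal.ofReal_ne_top]
  refine (rpow_le_rpow_sub_one_mul hq h1).trans (le_of_eq ?_)
  ring

/-! ### Averages of decreasing functions -/

/-- The average over `(0, a]` is at least `g a`, the average over `(a, b]` at most `g a`. Applied to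
`g` it makes `Sg` decreasing, applied to `w` it makes `W(t)/t` decreasing. -/
theorem ofReal_mul_setLIntegral_le {g : ℝ → ℝ≥0∞} (hg : AntitoneOn g (Ioi 0)) {a b : ℝ}
    (ha : 0 < a) (hab : a ≤ b) :
    ENNReal.ofReal a * ∫⁻ s in Ioc 0 b, g s ≤ ENNReal.ofReal b * ∫⁻ s in Ioc 0 a, g s := by
  have h1 : ENNReal.ofReal a * g a ≤ ∫⁻ s in Ioc 0 a, g s := by
    have : ∫⁻ _ in Ioc 0 a, g a ≤ ∫⁻ s in Ioc 0 a, g s :=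
      setLIntegral_mono' measurableSet_Ioc fun s hs => hg hs.1 ha hs.2
    simpa [mul_comm] using this
  have h2 : ∫⁻ s in Ioc a b, g s ≤ ENNReal.ofReal (b - a) * g a := by
    have : ∫⁻ s in Ioc a b, g s ≤ ∫⁻ _ in Ioc a b, g a :=
      setLIntegral_mono' measurableSet_Ioc fun s hs => hg ha (ha.trans hs.1) hs.1.le
    simpa [mul_comm] using this
  have h3 : ∫⁻ s in Ioc 0 b, g s = (∫⁻ s in Ioc 0 a, g s) + ∫⁻ s in Ioc a b, g s := by
    rw [← lintegral_union measurableSet_Ioc (Ioc_disjoint_Ioc_of_le le_rfl),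
      Ioc_union_Ioc_eq_Ioc ha.le hab]
  calc ENNReal.ofReal a * ∫⁻ s in Ioc 0 b, g s
      ≤ ENNReal.ofReal a * ((∫⁻ s in Ioc 0 a, g s) + ENNReal.ofReal (b - a) * g a) := by
        rw [h3]; gcongr
    _ = ENNReal.ofReal a * (∫⁻ s in Ioc 0 a, g s)
          + ENNReal.ofReal (b - a) * (ENNReal.ofReal a * g a) := by ring
    _ ≤ ENNReal.ofReal a * (∫⁻ s in Ioc 0 a, g s)
          + ENNReal.ofReal (b - a) * ∫⁻ s in Ioc 0 a, g s := by gcongr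
    _ = ENNReal.ofReal b * ∫⁻ s in Ioc 0 a, g s := by
        rw [← add_mul, ← ENNReal.ofReal_add ha.le (by linarith)]
        congr 2; ring

theorem hardyOp_antitoneOn {g : ℝ → ℝ≥0∞} (hg : AntitoneOn g (Ioi 0)) :
    AntitoneOn (hardyOp g) (Ioi 0) := by
  intro a (ha : 0 < a) b (hb : 0 < b) hab
  have ha' : ENNReal.ofReal a ≠ 0 := by simpa using ha
  have hb' : ENNReal.ofReal b ≠ 0 := by simpa using hb
  rw [hardyOp, hardyOp, ENNReal.div_le_iff hb' ENNReal.ofReal_ne_top, mul_comm, ← mul_div_assoc,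
    ENNReal.le_div_iff_mul_le (Or.inl ha') (Or.inl ENNReal.ofReal_ne_top), mul_comm]
  exact ofReal_mul_setLIntegral_le hg ha hab

theorem hardyOp_congr {f g : ℝ → ℝ≥0∞} (h : ∀ s, 0 < s → f s = g s) : hardyOp f = hardyOp g := by
  ext t
  rw [hardyOp, hardyOp, setLIntegral_congr_fun measurableSet_Ioc fun s hs => h s hs.1]

theorem AntitoneOn.aemeasurable_restrict_Ioi {g : ℝ → ℝ≥0∞} (hg : AntitoneOn g (Ioi 0)) :
    AEMeasurable g (volume.restrict (Ioi 0)) :=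
  aemeasurable_restrict_of_antitoneOn measurableSet_Ioi hg

/-! ### Weights and their primitives -/

section Weight

variable {w : ℝ → ℝ≥0}

theorem IsWeight.aemeasurable_coe (hw : IsWeight w) :
    AEMeasurable (fun t => (w t : ℝ≥0∞)) (volume.restrict (Ioi 0)) :=
  hw.aemeasurable.coe_nnreal_ennreal

theorem AntitoneOn.coe_nnreal_ennreal {g : ℝ → ℝ≥0} {s : Set ℝ} (hg : AntitoneOn g s) :
    AntitoneOn (fun t => (g t : ℝ≥0∞)) s :=
  fun _ ha _ hb hab => ENNReal.coe_le_coe.2 (hg ha hb hab)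

theorem weightPrimitive_mono (w : ℝ → ℝ≥0) : Monotone (weightPrimitive w) := fun _ _ h =>
  lintegral_mono_set (Ioc_subset_Ioc_right h)

theorem IsWeight.weightPrimitive_ne_top (hw : IsWeight w) (t : ℝ) : weightPrimitive w t ≠ ∞ := by
  have h1 : IntegrableOn (fun t => (w t : ℝ)) (Icc 0 t) :=
    hw.locallyIntegrable.integrableOn_compact_subset Icc_subset_Ici_self isCompact_Icc
  have h2 := (h1.mono_set Ioc_subset_Icc_self).2
  rw [hasFiniteIntegral_iff_enorm] at h2
  refine ne_of_lt (lt_of_le_of_lt (le_of_eq ?_) h2)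
  refine lintegral_congr fun s => ?_
  simp

theorem weightPrimitive_add {a b : ℝ} (ha : 0 ≤ a) (hab : a ≤ b) :
    weightPrimitive w b = weightPrimitive w a + ∫⁻ s in Ioc a b, (w s : ℝ≥0∞) := by
  rw [weightPrimitive, weightPrimitive,
    ← lintegral_union measurableSet_Ioc (Ioc_disjoint_Ioc_of_le le_rfl),
    Ioc_union_Ioc_eq_Ioc ha hab]

theorem weightPrimitive_eq_zero (h : ∀ t, 0 < t → w t = 0) (r : ℝ) : weightPrimitive w r = 0 := by
  rw [weightPrimitive, setLIntegral_congr_fun (g := fun _ => 0) measurableSet_Ioc]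
  · simp
  · intro s hs
    simp [h s hs.1]

theorem weightPrimitive_pos (hdec : AntitoneOn w (Ioi 0)) {t : ℝ} (ht : 0 < t) (hwt : w t ≠ 0)
    {r : ℝ} (hr : 0 < r) : 0 < weightPrimitive w r := by
  have h1 : ∫⁻ _ in Ioc 0 (min r t), (w t : ℝ≥0∞) ≤ weightPrimitive w (min r t) :=
    setLIntegral_mono' measurableSet_Ioc fun s hs =>
      ENNReal.coe_le_coe.2 (hdec hs.1 ht (hs.2.trans (min_le_right _ _)))
  refine lt_of_lt_of_le ?_ (h1.trans (weightPrimitive_mono w (min_le_left _ _)))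
  simp [pos_iff_ne_zero, hwt, hr, ht]

theorem weightMeasure_apply (w : ℝ → ℝ≥0) {A : Set ℝ} (hA : MeasurableSet A) (hA0 : A ⊆ Ioi 0) :
    weightMeasure w A = ∫⁻ t in A, (w t : ℝ≥0∞) := by
  rw [weightMeasure, withDensity_apply _ hA, Measure.restrict_restrict hA,
    inter_eq_self_of_subset_left hA0]

theorem IsWeight.lintegral_weightMeasure (hw : IsWeight w) {h : ℝ → ℝ≥0∞}
    (hh : AEMeasurable h (volume.restrict (Ioi 0))) :
    ∫⁻ t, h t ∂(weightMeasure w) = ∫⁻ t in Ioi (0 : ℝ), h t * (w t : ℝ≥0∞) := by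
  rw [weightMeasure, lintegral_withDensity_eq_lintegral_mul₀ hw.aemeasurable_coe hh]
  refine lintegral_congr fun t => ?_
  simp [mul_comm]

theorem weightedLpNorm_one (w : ℝ → ℝ≥0) (g : ℝ → ℝ≥0∞) :
    weightedLpNorm 1 w g = ∫⁻ t in Ioi (0 : ℝ), g t * (w t : ℝ≥0∞) := by
  simp [weightedLpNorm]

/-- A nonzero decreasing weight has positive mass near `0`, where `g` is largest. This allows
passing from `[0, ∞]`-valued functions to the finite-valued cone. -/
theorem lt_top_of_lintegral_mul_lt_top (hdec : AntitoneOn w (Ioi 0)) {t₀ : ℝ} (ht₀ : 0 < t₀)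
    (hwt : w t₀ ≠ 0) {g : ℝ → ℝ≥0∞} (hg : AntitoneOn g (Ioi 0))
    (hfin : ∫⁻ t in Ioi (0 : ℝ), g t * (w t : ℝ≥0∞) < ∞) {t : ℝ} (ht : 0 < t) : g t < ∞ := by
  by_contra! htop
  rw [top_le_iff] at htop
  refine hfin.ne (top_le_iff.1 ?_)
  have hpos := weightPrimitive_pos hdec ht₀ hwt ht
  calc ∞ = ∞ * weightPrimitive w t := by rw [ENNReal.top_mul hpos.ne']
    _ ≤ ∫⁻ s in Ioc 0 t, ∞ * (w s : ℝ≥0∞) := lintegral_const_mul_le _ _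
    _ ≤ ∫⁻ s in Ioc 0 t, g s * (w s : ℝ≥0∞) := by
        refine setLIntegral_mono' measurableSet_Ioc fun s hs => ?_
        rw [← htop]
        gcongr
        exact hg hs.1 ht hs.2
    _ ≤ _ := lintegral_mono_set fun s hs => hs.1

/-- Since `Sg` decreases, `Sg(t) W(t) ≤ ∫_0^t Sg w ≤ I`; spend `q - 1` powers of the integrand on
this bound and integrate the remaining `Sg w`. -/
theorem lintegral_hardyOp_rpow_le {q : ℝ} (hq : 1 < q) (hw : IsWeight w) {g : ℝ → ℝ≥0∞}
    (hg : AntitoneOn g (Ioi 0)) :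
    ∫⁻ t in Ioi (0 : ℝ), hardyOp g t ^ q * weightPrimitive w t ^ (q / 1 - 1) * (w t : ℝ≥0∞)
      ≤ (∫⁻ t in Ioi (0 : ℝ), hardyOp g t * (w t : ℝ≥0∞)) ^ q := by
  set I := ∫⁻ t in Ioi (0 : ℝ), hardyOp g t * (w t : ℝ≥0∞) with hI
  have hS := hardyOp_antitoneOn hg
  rw [← rpow_sub_one_mul_self hq]
  nth_rw 2 [hI]
  have hm : AEMeasurable (fun t => hardyOp g t * (w t : ℝ≥0∞)) (volume.restrict (Ioi 0)) :=
    hS.aemeasurable_restrict_Ioi.mul hw.aemeasurable_coe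
  rw [← lintegral_const_mul'' _ hm]
  refine setLIntegral_mono' measurableSet_Ioi fun t (ht : 0 < t) => ?_
  have h1 : hardyOp g t * weightPrimitive w t ≤ I := by
    calc hardyOp g t * weightPrimitive w t
        ≤ ∫⁻ s in Ioc 0 t, hardyOp g t * (w s : ℝ≥0∞) := lintegral_const_mul_le _ _
      _ ≤ ∫⁻ s in Ioc 0 t, hardyOp g s * (w s : ℝ≥0∞) := by
          refine setLIntegral_mono' measurableSet_Ioc fun s hs => ?_
          gcongr
          exact hS hs.1 ht hs.2
      _ ≤ I := lintegral_mono_set fun s hs => hs.1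
  have hq1 : 0 ≤ q - 1 := by linarith
  calc hardyOp g t ^ q * weightPrimitive w t ^ (q / 1 - 1) * (w t : ℝ≥0∞)
      = (hardyOp g t * weightPrimitive w t) ^ (q - 1) * (hardyOp g t * (w t : ℝ≥0∞)) := by
        rw [div_one, ← rpow_sub_one_mul_self hq, ENNReal.mul_rpow_of_nonneg _ _ hq1]
        ring
    _ ≤ _ := by gcongr

end Weight

/-! ### Duality for the Hardy operator, and `B_1` implies strong type -/

theorem lintegral_setLIntegral_mul {g k : ℝ → ℝ≥0∞}
    (hg : AEMeasurable g (volume.restrict (Ioi 0))) (hk : AEMeasurable k (volume.restrict (Ioi 0))) :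
    ∫⁻ t in Ioi (0 : ℝ), (∫⁻ s in Ioc 0 t, g s) * k t
      = ∫⁻ s in Ioi (0 : ℝ), g s * ∫⁻ t in Ici s, k t := by
  have hT : MeasurableSet {p : ℝ × ℝ | p.2 ≤ p.1} := measurableSet_le measurable_snd measurable_fst
  have hm : AEMeasurable (Function.uncurry fun t s : ℝ =>
      {p : ℝ × ℝ | p.2 ≤ p.1}.indicator (fun p => g p.2 * k p.1) (t, s))
      ((volume.restrict (Ioi 0)).prod (volume.restrict (Ioi 0))) :=
    (hg.comp_snd.mul hk.comp_fst).indicator hT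
  calc ∫⁻ t in Ioi (0 : ℝ), (∫⁻ s in Ioc 0 t, g s) * k t
      = ∫⁻ t in Ioi (0 : ℝ), ∫⁻ s in Ioi (0 : ℝ),
          {p : ℝ × ℝ | p.2 ≤ p.1}.indicator (fun p => g p.2 * k p.1) (t, s) := by
        refine setLIntegral_congr_fun measurableSet_Ioi fun t (ht : 0 < t) => ?_
        have hsub : Ioc 0 t ⊆ Ioi 0 := fun s hs => hs.1
        have hgt : AEMeasurable g (volume.restrict (Ioc 0 t)) := hg.mono_set hsub
        rw [← lintegral_mul_const'' _ hgt, ← lintegral_indicator measurableSet_Ioc,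
          ← lintegral_indicator measurableSet_Ioi]
        refine lintegral_congr fun s => ?_
        simp only [indicator, mem_Ioc, mem_Ioi, mem_ofPred_eq]
        split_ifs <;> simp_all
    _ = ∫⁻ s in Ioi (0 : ℝ), ∫⁻ t in Ioi (0 : ℝ),
          {p : ℝ × ℝ | p.2 ≤ p.1}.indicator (fun p => g p.2 * k p.1) (t, s) :=
        lintegral_lintegral_swap hm
    _ = ∫⁻ s in Ioi (0 : ℝ), g s * ∫⁻ t in Ici s, k t := by
        refine setLIntegral_congr_fun measurableSet_Ioi fun s (hs : 0 < s) => ?_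
        have hsub : Ici s ⊆ Ioi 0 := fun t ht => hs.trans_le ht
        have hkt : AEMeasurable k (volume.restrict (Ici s)) := hk.mono_set hsub
        rw [← lintegral_const_mul'' _ hkt, ← lintegral_indicator measurableSet_Ici,
          ← lintegral_indicator measurableSet_Ioi]
        refine lintegral_congr fun t => ?_
        simp only [indicator, mem_Ici, mem_Ioi, mem_ofPred_eq]
        by_cases h : s ≤ t
        · simp [h, hs.trans_le h]
        · simp [h]

variable {w : ℝ → ℝ≥0}

theorem hardyOp_mul (g : ℝ → ℝ≥0∞) (t : ℝ) :
    hardyOp g t * (w t : ℝ≥0∞) = (∫⁻ s in Ioc 0 t, g s) * ((w t : ℝ≥0∞) / ENNReal.ofReal t) := by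
  rw [hardyOp, div_eq_mul_inv, div_eq_mul_inv]
  ring

theorem IsWeight.aemeasurable_div (hw : IsWeight w) :
    AEMeasurable (fun t => (w t : ℝ≥0∞) / ENNReal.ofReal t) (volume.restrict (Ioi 0)) :=
  hw.aemeasurable_coe.div ENNReal.measurable_ofReal.aemeasurable

/-- The dual weight `s ↦ ∫_s^∞ w(t) dt / t` of the Hardy operator. -/
noncomputable def dualWeight (w : ℝ → ℝ≥0) (s : ℝ) : ℝ≥0∞ :=
  ∫⁻ t in Ici s, (w t : ℝ≥0∞) / ENNReal.ofReal t

theorem dualWeight_antitone (w : ℝ → ℝ≥0) : Antitone (dualWeight w) := fun _ _ h =>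
  lintegral_mono_set (Ici_subset_Ici.2 h)

theorem IsWeight.lintegral_hardyOp_mul (hw : IsWeight w) {g : ℝ → ℝ≥0∞}
    (hg : AEMeasurable g (volume.restrict (Ioi 0))) :
    ∫⁻ t in Ioi (0 : ℝ), hardyOp g t * (w t : ℝ≥0∞)
      = ∫⁻ s in Ioi (0 : ℝ), g s * dualWeight w s := by
  simp_rw [hardyOp_mul]
  exact lintegral_setLIntegral_mul hg hw.aemeasurable_div

theorem IsWeight.setLIntegral_Ioi_dualWeight (hw : IsWeight w) :
    ∫⁻ s in Ioi (0 : ℝ), dualWeight w s = ∫⁻ t in Ioi (0 : ℝ), (w t : ℝ≥0∞) := by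
  have h := hw.lintegral_hardyOp_mul (g := fun _ => 1) aemeasurable_const
  simp only [one_mul] at h
  rw [← h]
  refine setLIntegral_congr_fun measurableSet_Ioi fun t (ht : 0 < t) => ?_
  have ht' : ENNReal.ofReal t ≠ 0 := by simpa using ht
  simp [hardyOp, ENNReal.div_self ht' ENNReal.ofReal_ne_top]

/-- Duality with `g = 1_(0,r]`, for which `Sg(t) ≤ min(1, r/t)`. -/
theorem IsWeight.setLIntegral_Ioc_dualWeight_le (hw : IsWeight w) (r : ℝ) (hr : 0 < r) :
    ∫⁻ s in Ioc 0 r, dualWeight w s ≤ weightPrimitive w r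
      + ENNReal.ofReal r * ∫⁻ t in Ioi r, (w t : ℝ≥0∞) / ENNReal.ofReal t := by
  have hind : ∀ s, (Ioc 0 r).indicator (dualWeight w) s
      = (Ioc 0 r).indicator (fun _ => (1 : ℝ≥0∞)) s * dualWeight w s := by
    intro s
    by_cases h : s ∈ Ioc 0 r <;> simp [h]
  have h1 : ∫⁻ s in Ioc 0 r, dualWeight w s
      = ∫⁻ t in Ioi (0 : ℝ), hardyOp ((Ioc 0 r).indicator fun _ => 1) t * (w t : ℝ≥0∞) := by
    rw [hw.lintegral_hardyOp_mul ((measurable_const.indicator measurableSet_Ioc).aemeasurable)]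
    simp_rw [← hind]
    rw [lintegral_indicator measurableSet_Ioc, Measure.restrict_restrict measurableSet_Ioc,
      inter_eq_self_of_subset_left (fun s hs => hs.1)]
  have h2 : ∀ t, ∫⁻ s in Ioc 0 t, (Ioc 0 r).indicator (fun _ => (1 : ℝ≥0∞)) s
      ≤ ENNReal.ofReal (min t r) := by
    intro t
    rw [lintegral_indicator measurableSet_Ioc, Measure.restrict_restrict measurableSet_Ioc,
      Ioc_inter_Ioc]
    simp [min_comm]
  rw [h1, ← Ioc_union_Ioi_eq_Ioi hr.le, lintegral_union measurableSet_Ioi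
    (disjoint_left.2 fun x hx hx' => not_lt.2 hx.2 hx')]
  refine add_le_add ?_ ?_
  · refine setLIntegral_mono' measurableSet_Ioc fun t ht => ?_
    refine mul_le_of_le_one_left zero_le (ENNReal.div_le_of_le_mul ?_)
    rw [one_mul]
    exact (h2 t).trans (ENNReal.ofReal_le_ofReal (min_le_left _ _))
  · rw [← lintegral_const_mul' _ _ ENNReal.ofReal_ne_top]
    refine setLIntegral_mono' measurableSet_Ioi fun t ht => ?_
    rw [hardyOp_mul]
    gcongr
    exact (h2 t).trans (ENNReal.ofReal_le_ofReal (min_le_right _ _))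

/-- Up to its right endpoint, a null set, a nonempty `B` is `(0, sup B]` or the whole half-line;
`h0` covers the latter. -/
theorem setLIntegral_le_of_initial {v u : ℝ → ℝ≥0∞} {K : ℝ≥0∞}
    (h0 : ∫⁻ s in Ioi (0 : ℝ), v s ≤ K * ∫⁻ s in Ioi (0 : ℝ), u s)
    (h : ∀ r, 0 < r → ∫⁻ s in Ioc 0 r, v s ≤ K * ∫⁻ s in Ioc 0 r, u s)
    {B : Set ℝ} (hB0 : B ⊆ Ioi 0) (hB : ∀ x ∈ B, ∀ y, 0 < y → y ≤ x → y ∈ B) :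
    ∫⁻ s in B, v s ≤ K * ∫⁻ s in B, u s := by
  rcases B.eq_empty_or_nonempty with rfl | ⟨x, hx⟩
  · simp
  by_cases hb : BddAbove B
  · have hr : 0 < sSup B := lt_of_lt_of_le (hB0 hx) (le_csSup hb hx)
    have h1 : B ⊆ Ioc 0 (sSup B) := fun y hy => ⟨hB0 hy, le_csSup hb hy⟩
    have h2 : Ioo 0 (sSup B) ⊆ B := fun y hy => by
      obtain ⟨z, hz, hyz⟩ := exists_lt_of_lt_csSup ⟨x, hx⟩ hy.2
      exact hB z hz y hy.1 hyz.le
    calc ∫⁻ s in B, v s ≤ ∫⁻ s in Ioc 0 (sSup B), v s := lintegral_mono_set h1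
      _ ≤ K * ∫⁻ s in Ioc 0 (sSup B), u s := h _ hr
      _ = K * ∫⁻ s in Ioo 0 (sSup B), u s := by rw [Measure.restrict_congr_set Ioo_ae_eq_Ioc]
      _ ≤ K * ∫⁻ s in B, u s := by gcongr
  · have : B = Ioi 0 := by
      refine hB0.antisymm fun y hy => ?_
      obtain ⟨z, hz, hyz⟩ := not_bddAbove_iff.1 hb y
      exact hB z hz y hy hyz.le
    rw [this]
    exact h0

theorem BClass.lintegral_hardyOp_le (hw : IsWeight w) (hB : BClass 1 w) :
    ∃ C : ℝ≥0, ∀ g : ℝ → ℝ≥0∞, AntitoneOn g (Ioi 0) →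
      ∫⁻ t in Ioi (0 : ℝ), hardyOp g t * (w t : ℝ≥0∞)
        ≤ C * ∫⁻ t in Ioi (0 : ℝ), g t * (w t : ℝ≥0∞) := by
  obtain ⟨C, hC⟩ := hB
  refine ⟨1 + C, fun g hg => ?_⟩
  have hgm := hg.aemeasurable_restrict_Ioi
  have hvm : Measurable (dualWeight w) := (dualWeight_antitone w).measurable
  have hr : ∀ r, 0 < r → ∫⁻ s in Ioc 0 r, dualWeight w s
      ≤ (1 + C : ℝ≥0) * ∫⁻ s in Ioc 0 r, (w s : ℝ≥0∞) := by
    intro r hr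
    have hr' : ENNReal.ofReal r ≠ 0 := by simpa using hr
    refine (hw.setLIntegral_Ioc_dualWeight_le r hr).trans ?_
    have := hC r hr
    simp only [ENNReal.rpow_one] at this
    push_cast
    rw [add_mul, one_mul]
    refine add_le_add le_rfl ?_
    refine (mul_le_mul_right this _).trans (le_of_eq ?_)
    rw [← mul_assoc, ENNReal.mul_div_cancel hr' ENNReal.ofReal_ne_top]
  have h0 : ∫⁻ s in Ioi (0 : ℝ), dualWeight w s
      ≤ (1 + C : ℝ≥0) * ∫⁻ s in Ioi (0 : ℝ), (w s : ℝ≥0∞) := by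
    rw [hw.setLIntegral_Ioi_dualWeight]
    refine le_mul_of_one_le_left zero_le ?_
    push_cast
    exact le_self_add
  rw [hw.lintegral_hardyOp_mul hgm]
  have e1 : ∫⁻ s in Ioi (0 : ℝ), g s * dualWeight w s
      = ∫⁻ s, g s ∂((volume.restrict (Ioi 0)).withDensity (dualWeight w)) := by
    rw [lintegral_withDensity_eq_lintegral_mul₀ hvm.aemeasurable hgm]
    refine lintegral_congr fun t => ?_
    simp [mul_comm]
  have e2 : ∫⁻ s in Ioi (0 : ℝ), g s * (w s : ℝ≥0∞)
      = ∫⁻ s, g s ∂((volume.restrict (Ioi 0)).withDensity fun s => (w s : ℝ≥0∞)) := by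
    rw [lintegral_withDensity_eq_lintegral_mul₀ hw.aemeasurable_coe hgm]
    refine lintegral_congr fun t => ?_
    simp [mul_comm]
  rw [e1, e2, lintegral_eq_lintegral_measure_ofReal_lt
      (hgm.mono_ac (withDensity_absolutelyContinuous _ _)),
    lintegral_eq_lintegral_measure_ofReal_lt
      (hgm.mono_ac (withDensity_absolutelyContinuous _ _)),
    ← lintegral_const_mul' _ _ ENNReal.coe_ne_top]
  refine lintegral_mono fun l => ?_
  dsimp only
  rw [withDensity_apply', withDensity_apply', Measure.restrict_restrict' measurableSet_Ioi]
  refine setLIntegral_le_of_initial h0 hr inter_subset_right ?_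
  rintro x ⟨hx, hx0⟩ y hy hyx
  exact ⟨lt_of_lt_of_le (b := g x) hx (hg hy hx0 hyx), hy⟩

/-! ### Geometric decay of `W(t)/t` implies `B_1` -/

/-- Iteration gives `W(c^k r) ≤ (c/2)^k W(r)`. On the `k`-th block `1/s ≤ 1/(c^k r)`, so it
contributes at most `2^(-k) c W(r)/(2r)`, and the series sums to `c W(r)/r`. -/
theorem bClass_one_of_decay {c : ℝ} (hc : 1 < c)
    (h : ∀ r, 0 < r → weightPrimitive w (c * r) ≤ ENNReal.ofReal (c / 2) * weightPrimitive w r) :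
    BClass 1 w := by
  refine ⟨c.toNNReal, fun r hr => ?_⟩
  have hc0 : 0 < c := by linarith
  have hpow : ∀ k : ℕ, weightPrimitive w (c ^ k * r)
      ≤ ENNReal.ofReal ((c / 2) ^ k) * weightPrimitive w r := by
    intro k
    induction k with
    | zero => simp
    | succ k ih =>
      have := h (c ^ k * r) (by positivity)
      rw [← mul_assoc, ← pow_succ'] at this
      refine this.trans ((mul_le_mul_right ih _).trans (le_of_eq ?_))
      rw [← mul_assoc, ← ENNReal.ofReal_mul (by positivity), ← pow_succ']
  have hcover : Ioi r ⊆ ⋃ k : ℕ, Ico (c ^ k * r) (c ^ (k + 1) * r) := by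
    intro s (hs : r < s)
    obtain ⟨k, hk1, hk2⟩ := exists_nat_pow_near (x := s / r) ((one_le_div hr).2 hs.le) hc
    exact mem_iUnion.2 ⟨k, (le_div_iff₀ hr).1 hk1, (div_lt_iff₀ hr).1 hk2⟩
  have hblock : ∀ k : ℕ, ∫⁻ s in Ico (c ^ k * r) (c ^ (k + 1) * r),
      (w s : ℝ≥0∞) / ENNReal.ofReal s
        ≤ 2⁻¹ ^ k * (ENNReal.ofReal (c / (2 * r)) * weightPrimitive w r) := by
    intro k
    have ha : 0 < c ^ k * r := by positivity
    have ha' : ENNReal.ofReal (c ^ k * r) ≠ 0 := by simpa using ha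
    calc ∫⁻ s in Ico (c ^ k * r) (c ^ (k + 1) * r), (w s : ℝ≥0∞) / ENNReal.ofReal s
        ≤ ∫⁻ s in Ico (c ^ k * r) (c ^ (k + 1) * r),
            (ENNReal.ofReal (c ^ k * r))⁻¹ * (w s : ℝ≥0∞) := by
          refine setLIntegral_mono' measurableSet_Ico fun s hs => ?_
          rw [div_eq_mul_inv, mul_comm]
          gcongr
          exact hs.1
      _ = (ENNReal.ofReal (c ^ k * r))⁻¹ * ∫⁻ s in Ico (c ^ k * r) (c ^ (k + 1) * r),
            (w s : ℝ≥0∞) := lintegral_const_mul' _ _ (ENNReal.inv_ne_top.2 ha')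
      _ ≤ (ENNReal.ofReal (c ^ k * r))⁻¹ * weightPrimitive w (c ^ (k + 1) * r) := by
          rw [weightPrimitive]
          gcongr
          exact fun s hs => ⟨ha.trans_le hs.1, hs.2.le⟩
      _ ≤ (ENNReal.ofReal (c ^ k * r))⁻¹
            * (ENNReal.ofReal ((c / 2) ^ (k + 1)) * weightPrimitive w r) := by
          gcongr
          exact hpow _
      _ = 2⁻¹ ^ k * (ENNReal.ofReal (c / (2 * r)) * weightPrimitive w r) := by
          have h2 : (2⁻¹ : ℝ≥0∞) = ENNReal.ofReal 2⁻¹ := by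
            rw [ENNReal.ofReal_inv_of_pos two_pos]; simp
          rw [← mul_assoc, ← mul_assoc, h2, ← ENNReal.ofReal_inv_of_pos ha,
            ← ENNReal.ofReal_pow (by norm_num), ← ENNReal.ofReal_mul (by positivity),
            ← ENNReal.ofReal_mul (by positivity)]
          congr 2
          rw [div_pow, pow_succ, pow_succ, inv_pow]
          field_simp
  simp only [ENNReal.rpow_one]
  calc ∫⁻ s in Ioi r, (w s : ℝ≥0∞) / ENNReal.ofReal s
      ≤ ∫⁻ s in ⋃ k : ℕ, Ico (c ^ k * r) (c ^ (k + 1) * r), (w s : ℝ≥0∞) / ENNReal.ofReal s :=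
        lintegral_mono_set hcover
    _ ≤ ∑' k : ℕ, ∫⁻ s in Ico (c ^ k * r) (c ^ (k + 1) * r), (w s : ℝ≥0∞) / ENNReal.ofReal s :=
        lintegral_iUnion_le _ _
    _ ≤ ∑' k : ℕ, 2⁻¹ ^ k * (ENNReal.ofReal (c / (2 * r)) * weightPrimitive w r) :=
        ENNReal.tsum_le_tsum hblock
    _ = ENNReal.ofReal c / ENNReal.ofReal r * weightPrimitive w r := by
        rw [ENNReal.tsum_mul_right, ENNReal.tsum_geometric_two, ← mul_assoc,
          ← ENNReal.ofReal_div_of_pos hr]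
        congr 1
        rw [show (2 : ℝ≥0∞) = ENNReal.ofReal 2 by simp, ← ENNReal.ofReal_mul (by norm_num)]
        congr 1
        field_simp

/-! ### Lower bounds when the decay fails -/

theorem sum_setLIntegral_Ioc_le {x : ℕ → ℝ} (hx : Monotone x) (F : ℝ → ℝ≥0∞) (n : ℕ) :
    ∑ k ∈ Finset.range n, ∫⁻ t in Ioc (x k) (x (k + 1)), F t ≤ ∫⁻ t in Ioc (x 0) (x n), F t := by
  induction n with
  | zero => simp
  | succ n ih =>
    rw [Finset.sum_range_succ, ← Ioc_union_Ioc_eq_Ioc (hx (Nat.zero_le n)) (hx (Nat.le_succ n)),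
      lintegral_union measurableSet_Ioc (Ioc_disjoint_Ioc_of_le le_rfl)]
    exact add_le_add ih le_rfl

theorem natCast_mul_le_setLIntegral_Ioi {x : ℕ → ℝ} (hx : Monotone x) (hx0 : 0 ≤ x 0)
    {F : ℝ → ℝ≥0∞} {B : ℝ≥0∞} {n : ℕ}
    (h : ∀ k < n, B ≤ ∫⁻ t in Ioc (x k) (x (k + 1)), F t) :
    (n : ℝ≥0∞) * B ≤ ∫⁻ t in Ioi (0 : ℝ), F t := by
  calc (n : ℝ≥0∞) * B = ∑ _k ∈ Finset.range n, B := by simp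
    _ ≤ ∑ k ∈ Finset.range n, ∫⁻ t in Ioc (x k) (x (k + 1)), F t :=
        Finset.sum_le_sum fun k hk => h k (Finset.mem_range.1 hk)
    _ ≤ ∫⁻ t in Ioc (x 0) (x n), F t := sum_setLIntegral_Ioc_le hx F n
    _ ≤ _ := lintegral_mono_set fun t ht => hx0.trans_lt ht.1

section Blocks

theorem IsWeight.ofReal_mul_le (hw : IsWeight w) (hdec : AntitoneOn w (Ioi 0)) {a b : ℝ}
    (ha : 0 < a) (hab : a ≤ b) :
    a * (weightPrimitive w b).toReal ≤ b * (weightPrimitive w a).toReal := by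
  have h := ENNReal.toReal_mono
    (ENNReal.mul_ne_top ENNReal.ofReal_ne_top (hw.weightPrimitive_ne_top a))
    (ofReal_mul_setLIntegral_le hdec.coe_nnreal_ennreal ha hab)
  have hb : 0 ≤ b := ha.le.trans hab
  simpa [ENNReal.toReal_mul, ENNReal.toReal_ofReal ha.le, ENNReal.toReal_ofReal hb,
    weightPrimitive] using h

/-- Monotonicity of `W(t)/t` gives `W(b) ≥ b W(r)/(2r)` for `0 < b ≤ L r` and `W(a) ≤ a W(r)/r`. At
`b = 4a` the lower bound is `2a W(r)/r`, twice the upper bound for `W(a)`, so the block `(a, 4a]`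
keeps enough mass; this is why the ratio is 4. -/
theorem IsWeight.le_of_no_decay (hw : IsWeight w) (hdec : AntitoneOn w (Ioi 0)) {r L a : ℝ}
    (hr : 0 < r) (hra : r ≤ a) (haL : 4 * a ≤ L * r)
    (hL : ENNReal.ofReal (L / 2) * weightPrimitive w r < weightPrimitive w (L * r)) :
    ENNReal.ofReal (a * (weightPrimitive w r).toReal / (2 * r)) ≤ weightPrimitive w a ∧
    ENNReal.ofReal (a * (weightPrimitive w r).toReal / (2 * r))
      ≤ ∫⁻ s in Ioc a (4 * a), (w s : ℝ≥0∞) := by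
  have ha : 0 < a := hr.trans_le hra
  have hL0 : 0 < L := by
    by_contra! h
    nlinarith
  have hL' := ENNReal.toReal_mono (hw.weightPrimitive_ne_top _) hL.le
  rw [ENNReal.toReal_mul, ENNReal.toReal_ofReal (by positivity)] at hL'
  set V := fun t => (weightPrimitive w t).toReal with hV
  have hlow : ∀ b, 0 < b → b ≤ L * r → b * V r / (2 * r) ≤ V b := by
    intro b hb hbL
    have h1 : b * V (L * r) ≤ L * r * V b := hw.ofReal_mul_le hdec hb hbL
    have h2 : b * (L / 2 * V r) ≤ L * r * V b := (mul_le_mul_of_nonneg_left hL' hb.le).trans h1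
    rw [div_le_iff₀ (by positivity)]
    have h3 : L * (b * V r) ≤ L * (V b * (2 * r)) := by linarith
    exact le_of_mul_le_mul_left h3 hL0
  have hup : r * V a ≤ a * V r := hw.ofReal_mul_le hdec hr hra
  have h1 := hlow a ha (by linarith)
  have h2 := hlow (4 * a) (by linarith) haL
  have hVr : 0 ≤ V r := ENNReal.toReal_nonneg
  refine ⟨ENNReal.ofReal_le_of_le_toReal h1, ?_⟩
  have hadd := weightPrimitive_add (w := w) ha.le (show a ≤ 4 * a by linarith)
  have hfin : ∫⁻ s in Ioc a (4 * a), (w s : ℝ≥0∞) ≠ ∞ := fun h => by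
    rw [h, add_top] at hadd
    exact hw.weightPrimitive_ne_top _ hadd
  refine ENNReal.ofReal_le_of_le_toReal ?_
  have hadd' := congrArg ENNReal.toReal hadd
  rw [ENNReal.toReal_add (hw.weightPrimitive_ne_top _) hfin] at hadd'
  have h3 : V a ≤ a * V r / r := by rw [le_div_iff₀ hr]; linarith
  have h4 : 4 * a * V r / (2 * r) = 2 * (a * V r / r) := by field_simp; ring
  have h5 : a * V r / (2 * r) = (a * V r / r) / 2 := by field_simp
  have h6 : 0 ≤ a * V r / r := by positivity
  have hadd'' : V (4 * a) = V a + (∫⁻ s in Ioc a (4 * a), (w s : ℝ≥0∞)).toReal := hadd'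
  change a * V r / (2 * r) ≤ _
  linarith

theorem IsWeight.block_bound (hw : IsWeight w) (hdec : AntitoneOn w (Ioi 0)) {q : ℝ} (hq : 1 < q)
    {r L a c : ℝ} (hr : 0 < r) (hra : r ≤ a) (haL : 4 * a ≤ L * r) (hc : 0 ≤ c)
    (hL : ENNReal.ofReal (L / 2) * weightPrimitive w r < weightPrimitive w (L * r)) :
    ENNReal.ofReal (c * (weightPrimitive w r).toReal / 8) ^ q
      ≤ ENNReal.ofReal (c * r / (4 * a)) ^ q * weightPrimitive w a ^ (q - 1)
        * ∫⁻ s in Ioc a (4 * a), (w s : ℝ≥0∞) := by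
  obtain ⟨h1, h2⟩ := hw.le_of_no_decay hdec hr hra haL hL
  have ha : 0 < a := hr.trans_le hra
  have hq1 : 0 ≤ q - 1 := by linarith
  set Y := ENNReal.ofReal (a * (weightPrimitive w r).toReal / (2 * r))
  calc ENNReal.ofReal (c * (weightPrimitive w r).toReal / 8) ^ q
      = (ENNReal.ofReal (c * r / (4 * a)) * Y) ^ q := by
        rw [← ENNReal.ofReal_mul (by positivity)]
        congr 2
        field_simp
        ring
    _ = ENNReal.ofReal (c * r / (4 * a)) ^ q * Y ^ (q - 1) * Y := by
        rw [ENNReal.mul_rpow_of_nonneg _ _ (by linarith), mul_assoc, rpow_sub_one_mul_self hq]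
    _ ≤ _ := by gcongr

theorem four_pow_mul_mono {r : ℝ} (hr : 0 < r) : Monotone fun k : ℕ => (4 : ℝ) ^ k * r :=
  fun _ _ h => mul_le_mul_of_nonneg_right (pow_le_pow_right₀ (by norm_num) h) hr.le

/-- The hypothesis `hh` retains from `S(c 1_(0,r))` just the lower bound `cr/b` on `(0, b]`, so that
it also applies to larger functions. -/
theorem IsWeight.natCast_mul_le_gamma (hw : IsWeight w) (hdec : AntitoneOn w (Ioi 0)) {q : ℝ}
    (hq : 1 < q) {r c : ℝ} {N : ℕ} (hr : 0 < r) (hc : 0 ≤ c)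
    (hL : ENNReal.ofReal (4 ^ N / 2) * weightPrimitive w r < weightPrimitive w (4 ^ N * r))
    {h : ℝ → ℝ≥0∞} (hh : ∀ b, r ≤ b → ∀ t ∈ Ioc 0 b, ENNReal.ofReal (c * r / b) ≤ h t) :
    (N : ℝ≥0∞) * ENNReal.ofReal (c * (weightPrimitive w r).toReal / 8) ^ q
      ≤ ∫⁻ t in Ioi (0 : ℝ), h t ^ q * weightPrimitive w t ^ (q / 1 - 1) * (w t : ℝ≥0∞) := by
  have hq1 : 0 ≤ q - 1 := by linarith
  refine natCast_mul_le_setLIntegral_Ioi (four_pow_mul_mono hr) (by simpa using hr.le)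
    fun k hk => ?_
  have hra : r ≤ 4 ^ k * r := by simpa using four_pow_mul_mono hr (Nat.zero_le k)
  have haL : 4 * (4 ^ k * r) ≤ 4 ^ N * r := by
    have := four_pow_mul_mono hr (Nat.succ_le_of_lt hk)
    simp only [Nat.succ_eq_add_one, pow_succ] at this
    linarith
  have he : (4 : ℝ) ^ (k + 1) * r = 4 * (4 ^ k * r) := by ring
  refine (hw.block_bound hdec hq hr hra haL hc hL).trans ((lintegral_const_mul_le _ _).trans ?_)
  rw [he]
  refine setLIntegral_mono' measurableSet_Ioc fun t ht => ?_
  have ha : 0 < 4 ^ k * r := by positivity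
  rw [div_one]
  gcongr
  · exact hh _ (by linarith) t ⟨ha.trans ht.1, ht.2⟩
  · exact weightPrimitive_mono w ht.1.le

/-- The block `(a, 4a]` is transported by `s = W(t)` to an interval whose length is its `w`-mass,
and there `h^*(s) ≥ cr/(4a)`. -/
theorem IsWeight.natCast_mul_le_lorentz (hw : IsWeight w) (hdec : AntitoneOn w (Ioi 0)) {q : ℝ}
    (hq : 1 < q) {r c : ℝ} {N : ℕ} (hr : 0 < r) (hc : 0 ≤ c)
    (hL : ENNReal.ofReal (4 ^ N / 2) * weightPrimitive w r < weightPrimitive w (4 ^ N * r))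
    {h : ℝ → ℝ≥0∞} (hh : ∀ b, r ≤ b → ∀ t ∈ Ioc 0 b, ENNReal.ofReal (c * r / b) ≤ h t) :
    (N : ℝ≥0∞) * ENNReal.ofReal (c * (weightPrimitive w r).toReal / 8) ^ q
      ≤ ∫⁻ t in Ioi (0 : ℝ), (ENNReal.ofReal t ^ ((1 : ℝ) / 1)
          * rearrangement (weightMeasure w) h t) ^ q / ENNReal.ofReal t := by
  have hq1 : 0 ≤ q - 1 := by linarith
  have hVm : Monotone fun t => (weightPrimitive w t).toReal := fun s t hst =>
    ENNReal.toReal_mono (hw.weightPrimitive_ne_top t) (weightPrimitive_mono w hst)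
  refine natCast_mul_le_setLIntegral_Ioi (hVm.comp (four_pow_mul_mono hr)) ENNReal.toReal_nonneg
    fun k hk => ?_
  have hra : r ≤ 4 ^ k * r := by simpa using four_pow_mul_mono hr (Nat.zero_le k)
  have haL : 4 * (4 ^ k * r) ≤ 4 ^ N * r := by
    have := four_pow_mul_mono hr (Nat.succ_le_of_lt hk)
    simp only [Nat.succ_eq_add_one, pow_succ] at this
    linarith
  have he : (4 : ℝ) ^ (k + 1) * r = 4 * (4 ^ k * r) := by ring
  refine (hw.block_bound hdec hq hr hra haL hc hL).trans ?_
  simp only [Function.comp_apply]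
  rw [he]
  set a := 4 ^ k * r
  have ha : 0 < a := hr.trans_le hra
  have hvol : ∫⁻ s in Ioc a (4 * a), (w s : ℝ≥0∞)
      = volume (Ioo (weightPrimitive w a).toReal (weightPrimitive w (4 * a)).toReal) := by
    rw [Real.volume_Ioo, ENNReal.ofReal_sub _ ENNReal.toReal_nonneg,
      ENNReal.ofReal_toReal (hw.weightPrimitive_ne_top _),
      ENNReal.ofReal_toReal (hw.weightPrimitive_ne_top _),
      weightPrimitive_add (w := w) ha.le (show a ≤ 4 * a by linarith),
      ENNReal.add_sub_cancel_left (hw.weightPrimitive_ne_top _)]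
  -- The open interval provides the strict inequality `s < W(4a)` required by `le_rearrangement`.
  rw [hvol, ← setLIntegral_const, Measure.restrict_congr_set Ioo_ae_eq_Ioc.symm]
  refine setLIntegral_mono' measurableSet_Ioo fun s hs => ?_
  have hs0 : 0 < s := ENNReal.toReal_nonneg.trans_lt hs.1
  have hs0' : ENNReal.ofReal s ≠ 0 := by simpa using hs0
  have hWs : weightPrimitive w a ≤ ENNReal.ofReal s := by
    rw [← ENNReal.ofReal_toReal (hw.weightPrimitive_ne_top a)]
    exact ENNReal.ofReal_le_ofReal hs.1.le
  have hre : ENNReal.ofReal (c * r / (4 * a)) ≤ rearrangement (weightMeasure w) h s := by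
    refine le_rearrangement (lt_of_lt_of_le (b := weightMeasure w (Ioc 0 (4 * a))) ?_
      (measure_mono fun t ht => hh _ (by linarith) t ht))
    rw [weightMeasure_apply w measurableSet_Ioc fun t ht => ht.1]
    exact (ENNReal.ofReal_lt_iff_lt_toReal hs0.le (hw.weightPrimitive_ne_top _)).2 hs.2
  rw [div_one, ENNReal.rpow_one,
    ENNReal.le_div_iff_mul_le (Or.inl hs0') (Or.inl ENNReal.ofReal_ne_top),
    ENNReal.mul_rpow_of_nonneg _ _ (by linarith), ← rpow_sub_one_mul_self (x := ENNReal.ofReal s) hq]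
  calc ENNReal.ofReal (c * r / (4 * a)) ^ q * weightPrimitive w a ^ (q - 1) * ENNReal.ofReal s
      ≤ rearrangement (weightMeasure w) h s ^ q * ENNReal.ofReal s ^ (q - 1)
          * ENNReal.ofReal s := by gcongr
    _ = _ := by ring

theorem ofReal_le_hardyOp {G : ℝ → ℝ≥0∞} (hG : AntitoneOn G (Ioi 0)) {r c : ℝ} (hr : 0 < r)
    (hc : 0 ≤ c) (hcG : ∀ t ∈ Ioo 0 r, ENNReal.ofReal c ≤ G t) :
    ∀ b, r ≤ b → ∀ t ∈ Ioc 0 b, ENNReal.ofReal (c * r / b) ≤ hardyOp G t := by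
  intro b hrb t ht
  have hb : 0 < b := hr.trans_le hrb
  refine le_trans ?_ (hardyOp_antitoneOn hG ht.1 hb ht.2)
  rw [hardyOp, ENNReal.ofReal_div_of_pos hb]
  gcongr ?_ / _
  calc ENNReal.ofReal (c * r) = ∫⁻ _ in Ioo 0 r, ENNReal.ofReal c := by
        simp [ENNReal.ofReal_mul hc]
    _ ≤ ∫⁻ s in Ioo 0 r, G s := setLIntegral_mono' measurableSet_Ioo hcG
    _ ≤ ∫⁻ s in Ioc 0 b, G s := lintegral_mono_set fun s hs => ⟨hs.1, hs.2.le.trans hrb⟩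

/-- A sum of bumps `c_k 1_(0,r_k)`: each lies below the sum, so the lower bound of every single bump
is inherited. -/
theorem IsWeight.exists_extremal (hw : IsWeight w) (hdec : AntitoneOn w (Ioi 0)) (q : ℝ)
    (hnd : ∀ N : ℕ, 1 ≤ N → ∃ r, 0 < r ∧
      ENNReal.ofReal (4 ^ N / 2) * weightPrimitive w r < weightPrimitive w (4 ^ N * r)) :
    ∃ g : ℝ → ℝ≥0, Measurable g ∧ AntitoneOn g (Ioi 0) ∧
      ∫⁻ t in Ioi (0 : ℝ), (g t : ℝ≥0∞) * (w t : ℝ≥0∞) < ∞ ∧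
      ∀ k : ℕ, ∃ (N : ℕ) (r c : ℝ), 0 < r ∧ 0 ≤ c ∧
        ENNReal.ofReal (4 ^ N / 2) * weightPrimitive w r < weightPrimitive w (4 ^ N * r) ∧
        (∀ t ∈ Ioo 0 r, ENNReal.ofReal c ≤ g t) ∧
        (k : ℝ≥0∞) ≤ N * ENNReal.ofReal (c * (weightPrimitive w r).toReal / 8) ^ q := by
  obtain ⟨t₀, ht₀, hwt⟩ : ∃ t, 0 < t ∧ w t ≠ 0 := by
    by_contra! h
    obtain ⟨r, -, hr⟩ := hnd 1 le_rfl
    rw [weightPrimitive_eq_zero h, weightPrimitive_eq_zero h] at hr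
    simp at hr
  -- `N = M k` is chosen so that `N (2^(-k)/8)^q ≥ k`; the `+ 1` ensures `N ≥ 1`.
  set M : ℕ → ℕ := fun k => ⌈(k : ℝ) * (8 * 2 ^ k) ^ q⌉₊ + 1 with hM
  choose! ρ hρ0 hρ using hnd
  set r : ℕ → ℝ := fun k => ρ (M k) with hr
  have hr0 : ∀ k, 0 < r k := fun k => hρ0 _ (Nat.le_add_left _ _)
  have hV : ∀ k, 0 < (weightPrimitive w (r k)).toReal := fun k =>
    ENNReal.toReal_pos (weightPrimitive_pos hdec ht₀ hwt (hr0 k)).ne' (hw.weightPrimitive_ne_top _)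
  -- Normalized so that the `k`-th bump has `L^1(w)` norm `2^(-k)`.
  set c : ℕ → ℝ := fun k => (1 / 2) ^ k / (weightPrimitive w (r k)).toReal with hc
  have hc0 : ∀ k, 0 ≤ c k := fun k => by have := hV k; positivity
  set G : ℝ → ℝ≥0∞ := fun t => ∑' k, (Ioo 0 (r k)).indicator (fun _ => ENNReal.ofReal (c k)) t
    with hG
  have hGm : Measurable G :=
    Measurable.tsum fun k => measurable_const.indicator measurableSet_Ioo
  have hGa : AntitoneOn G (Ioi 0) := by
    intro s hs t ht hst
    refine ENNReal.tsum_le_tsum fun k => ?_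
    by_cases h : t ∈ Ioo 0 (r k)
    · rw [indicator_of_mem h, indicator_of_mem (show s ∈ Ioo 0 (r k) from ⟨hs, hst.trans_lt h.2⟩)]
    · rw [indicator_of_notMem h]
      exact zero_le
  have hGint : ∫⁻ t in Ioi (0 : ℝ), G t * (w t : ℝ≥0∞) < ∞ := by
    have hterm : ∀ k, ∫⁻ t in Ioi (0 : ℝ),
        (Ioo 0 (r k)).indicator (fun _ => ENNReal.ofReal (c k)) t * (w t : ℝ≥0∞) = 2⁻¹ ^ k := by
      intro k
      have : ∀ t, (Ioo 0 (r k)).indicator (fun _ => ENNReal.ofReal (c k)) t * (w t : ℝ≥0∞)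
          = (Ioo 0 (r k)).indicator (fun t => ENNReal.ofReal (c k) * (w t : ℝ≥0∞)) t := by
        intro t
        by_cases h : t ∈ Ioo 0 (r k) <;> simp [h]
      simp_rw [this]
      rw [lintegral_indicator measurableSet_Ioo, Measure.restrict_restrict measurableSet_Ioo,
        inter_eq_self_of_subset_left fun t ht => ht.1, lintegral_const_mul' _ _ ENNReal.ofReal_ne_top,
        Measure.restrict_congr_set Ioo_ae_eq_Ioc]
      change _ * weightPrimitive w (r k) = _
      rw [← ENNReal.ofReal_toReal (hw.weightPrimitive_ne_top (r k)), ← ENNReal.ofReal_mul (hc0 k),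
        hc, div_mul_cancel₀ _ (hV k).ne', ENNReal.ofReal_pow (by norm_num), one_div,
        ENNReal.ofReal_inv_of_pos two_pos]
      simp
    simp_rw [hG, ← ENNReal.tsum_mul_right]
    have hmeas : ∀ k, AEMeasurable (fun t => (Ioo 0 (r k)).indicator
        (fun _ => ENNReal.ofReal (c k)) t * (w t : ℝ≥0∞)) (volume.restrict (Ioi 0)) := fun k =>
      (measurable_const.indicator measurableSet_Ioo).aemeasurable.mul hw.aemeasurable_coe
    rw [lintegral_tsum hmeas]
    simp_rw [hterm]
    rw [ENNReal.tsum_geometric_two]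
    exact ENNReal.ofNat_lt_top
  have hGfin : ∀ t, 0 < t → G t ≠ ∞ := fun t ht =>
    (lt_top_of_lintegral_mul_lt_top hdec ht₀ hwt hGa hGint ht).ne
  have hcoe : ∀ t, 0 < t → ((G t).toNNReal : ℝ≥0∞) = G t := fun t ht =>
    ENNReal.coe_toNNReal (hGfin t ht)
  refine ⟨fun t => (G t).toNNReal, hGm.ennreal_toNNReal, ?_, ?_, fun k => ?_⟩
  · intro s hs t ht hst
    exact ENNReal.toNNReal_mono (hGfin s hs) (hGa hs ht hst)
  · rwa [setLIntegral_congr_fun (g := fun t => G t * (w t : ℝ≥0∞)) measurableSet_Ioi]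
    intro t ht
    simp only [hcoe t ht]
  · refine ⟨M k, r k, c k, hr0 k, hc0 k, hρ _ (Nat.le_add_left _ _), fun t ht => ?_, ?_⟩
    · rw [hcoe t ht.1]
      refine le_trans (le_of_eq ?_) (ENNReal.le_tsum k)
      rw [indicator_of_mem ht]
    · have e : c k * (weightPrimitive w (r k)).toReal / 8 = (8 * 2 ^ k)⁻¹ := by
        rw [hc, div_mul_cancel₀ _ (hV k).ne', one_div, inv_pow, mul_inv]
        ring
      have hp : (0 : ℝ) < 8 * 2 ^ k := by positivity
      have hpq : (0 : ℝ) < (8 * 2 ^ k) ^ q := Real.rpow_pos_of_pos hp q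
      rw [e, ENNReal.ofReal_rpow_of_pos (by positivity), Real.inv_rpow hp.le,
        ← ENNReal.ofReal_natCast, ← ENNReal.ofReal_natCast, ← ENNReal.ofReal_mul (by positivity)]
      refine ENNReal.ofReal_le_ofReal ?_
      rw [← div_eq_mul_inv, le_div_iff₀ hpq, hM]
      push_cast
      exact (Nat.le_ceil _).trans (by linarith)

end Blocks

/-! ### Radial realization on `ℝⁿ` -/

/-- The volume of the ball of radius `‖x‖` in `ℝⁿ`. -/
noncomputable def radialVolume (n : ℕ) (x : EuclideanSpace ℝ (Fin n)) : ℝ :=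
  (volume (Metric.ball (0 : EuclideanSpace ℝ (Fin n)) 1)).toReal * ‖x‖ ^ n

theorem radialVolume_measurable (n : ℕ) : Measurable (radialVolume n) := by
  unfold radialVolume
  fun_prop

theorem toReal_volume_ball_pos (n : ℕ) :
    0 < (volume (Metric.ball (0 : EuclideanSpace ℝ (Fin n)) 1)).toReal :=
  ENNReal.toReal_pos (Metric.measure_ball_pos _ _ one_pos).ne' measure_ball_lt_top.ne

theorem radialVolume_pos {n : ℕ} {x : EuclideanSpace ℝ (Fin n)} (hx : x ≠ 0) :
    0 < radialVolume n x :=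
  mul_pos (toReal_volume_ball_pos n) (pow_pos (norm_pos_iff.2 hx) n)

/-- Thus `radialVolume` is distributed like the identity on `(0, ∞)`, and composing with it
transfers a decreasing `g` to `ℝⁿ`. -/
theorem volume_radialVolume_lt {n : ℕ} (hn : 1 ≤ n) {t : ℝ} (ht : 0 < t) :
    volume {x | radialVolume n x < t} = ENNReal.ofReal t := by
  have hc := toReal_volume_ball_pos n
  set c := (volume (Metric.ball (0 : EuclideanSpace ℝ (Fin n)) 1)).toReal with hcdef
  have hn0 : n ≠ 0 := by omega
  have : Nonempty (Fin n) := ⟨⟨0, hn⟩⟩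
  set R : ℝ := (t / c) ^ ((n : ℝ)⁻¹)
  have hR : 0 ≤ R := by positivity
  have hRn : R ^ n = t / c := Real.rpow_inv_natCast_pow (by positivity) hn0
  have hset : {x | radialVolume n x < t} = Metric.ball (0 : EuclideanSpace ℝ (Fin n)) R := by
    ext x
    rw [mem_ball_zero_iff, ← pow_lt_pow_iff_left₀ (norm_nonneg x) hR hn0, hRn, lt_div_iff₀ hc,
      mul_comm]
    rfl
  rw [hset, Measure.addHaar_ball _ _ hR, finrank_euclideanSpace_fin, hRn,
    ← ENNReal.ofReal_toReal (measure_ball_lt_top (μ := volume)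
      (x := (0 : EuclideanSpace ℝ (Fin n))) (r := 1)).ne, ← ENNReal.ofReal_mul (by positivity),
    ← hcdef, div_mul_cancel₀ _ hc.ne']

theorem fStar_antitone {n : ℕ} (f : EuclideanSpace ℝ (Fin n) → ℝ≥0) : Antitone (fStar f) :=
  rearrangement_antitone _

theorem fStar_radial_le {n : ℕ} (hn : 1 ≤ n) {g : ℝ → ℝ≥0} (hg : AntitoneOn g (Ioi 0)) {t : ℝ}
    (ht : 0 < t) : fStar (fun x => g (radialVolume n x)) t ≤ g t := by
  refine rearrangement_le ?_
  rw [← volume_radialVolume_lt hn ht]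
  refine measure_mono_ae ?_
  have : Nonempty (Fin n) := ⟨⟨0, hn⟩⟩
  -- The origin is discarded: there `radialVolume` is `0`, outside the range where `g` is known to
  -- decrease.
  filter_upwards [Measure.ae_ne volume (0 : EuclideanSpace ℝ (Fin n))] with x hx0
  intro hx
  have hx' : (g t : ℝ≥0∞) < g (radialVolume n x) := hx
  change radialVolume n x < t
  by_contra! h
  exact (hx'.trans_le (ENNReal.coe_le_coe.2 (hg ht (radialVolume_pos hx0) h))).false

theorem le_fStar_radial {n : ℕ} (hn : 1 ≤ n) {g : ℝ → ℝ≥0} {a : ℝ≥0∞} {r : ℝ}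
    (hga : ∀ t ∈ Ioo 0 r, a ≤ g t) {t : ℝ} (ht : t ∈ Ioo 0 r) :
    a ≤ fStar (fun x => g (radialVolume n x)) t := by
  have hr : 0 < r := ht.1.trans ht.2
  refine le_rearrangement (lt_of_lt_of_le (b := volume {x | radialVolume n x < r}) ?_ ?_)
  · rw [volume_radialVolume_lt hn hr]
    exact (ENNReal.ofReal_lt_ofReal_iff hr).2 ht.2
  · refine measure_mono_ae ?_
    have : Nonempty (Fin n) := ⟨⟨0, hn⟩⟩
    filter_upwards [Measure.ae_ne volume (0 : EuclideanSpace ℝ (Fin n))] with x hx0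
    intro hx
    exact hga _ ⟨radialVolume_pos hx0, hx⟩

/-! ### The equivalences -/

variable {q : ℝ}

theorem bClass_one_of_not_exists_extremal (hw : IsWeight w) (hdec : AntitoneOn w (Ioi 0))
    (h : ∀ g : ℝ → ℝ≥0, Measurable g → AntitoneOn g (Ioi 0) →
      ∫⁻ t in Ioi (0 : ℝ), (g t : ℝ≥0∞) * (w t : ℝ≥0∞) < ∞ →
      ∃ k : ℕ, ∀ (N : ℕ) (r c : ℝ), 0 < r → 0 ≤ c →
        ENNReal.ofReal (4 ^ N / 2) * weightPrimitive w r < weightPrimitive w (4 ^ N * r) →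
        (∀ t ∈ Ioo 0 r, ENNReal.ofReal c ≤ g t) →
        (N * ENNReal.ofReal (c * (weightPrimitive w r).toReal / 8) ^ q : ℝ≥0∞) < k) :
    BClass 1 w := by
  by_contra hB
  have hnd : ∀ N : ℕ, 1 ≤ N → ∃ r, 0 < r ∧
      ENNReal.ofReal (4 ^ N / 2) * weightPrimitive w r < weightPrimitive w (4 ^ N * r) := by
    intro N hN
    by_contra! hN'
    exact hB (bClass_one_of_decay (one_lt_pow₀ (by norm_num) (by omega)) hN')
  obtain ⟨g, hgm, hga, hgi, hgk⟩ := hw.exists_extremal hdec q hnd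
  obtain ⟨k, hk⟩ := h g hgm hga hgi
  obtain ⟨N, r, c, hr, hc, hN, hcg, hkN⟩ := hgk k
  exact (hkN.trans_lt (hk N r c hr hc hN hcg)).false

theorem bClass_one_of_subset {n : ℕ} (hn : 1 ≤ n) (hq : 1 < q) (hw : IsWeight w)
    (hdec : AntitoneOn w (Ioi 0)) (h : LambdaSpace n 1 w ⊆ GammaSpace n 1 q w) :
    BClass 1 w := by
  refine bClass_one_of_not_exists_extremal (q := q) hw hdec fun g hgm hga hgi => ?_
  set f : EuclideanSpace ℝ (Fin n) → ℝ≥0 := fun x => g (radialVolume n x)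
  have hf : f ∈ LambdaSpace n 1 w := by
    refine ⟨(hgm.comp (radialVolume_measurable n)).aemeasurable, ?_⟩
    rw [lambdaNorm, one_div_one, ENNReal.rpow_one]
    refine lt_of_le_of_lt (setLIntegral_mono' measurableSet_Ioi fun t ht => ?_) hgi
    rw [ENNReal.rpow_one]
    gcongr
    exact fStar_radial_le hn hga ht
  have hfin := (h hf).2
  rw [gammaNorm, ENNReal.rpow_lt_top_iff_of_pos (by positivity)] at hfin
  obtain ⟨k, hk⟩ := ENNReal.exists_nat_gt hfin.ne
  refine ⟨k, fun N r c hr hc hN hcg => lt_of_le_of_lt ?_ hk⟩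
  exact hw.natCast_mul_le_gamma hdec hq hr hc hN
    (ofReal_le_hardyOp ((fStar_antitone f).antitoneOn _) hr hc fun t ht => le_fStar_radial hn hcg ht)

theorem bClass_one_of_mem_weightedLorentz (hq : 1 < q) (hw : IsWeight w)
    (hdec : AntitoneOn w (Ioi 0))
    (h : ∀ f ∈ LpDec 1 w, hardyOp (fun t => (f t : ℝ≥0∞)) ∈ WeightedLorentz 1 q w) :
    BClass 1 w := by
  refine bClass_one_of_not_exists_extremal (q := q) hw hdec fun g hgm hga hgi => ?_
  have hfin := (h g ⟨hga, by rwa [weightedLpNorm_one]⟩).2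
  rw [weightedLorentzNorm, ENNReal.rpow_lt_top_iff_of_pos (by positivity)] at hfin
  obtain ⟨k, hk⟩ := ENNReal.exists_nat_gt hfin.ne
  refine ⟨k, fun N r c hr hc hN hcg => lt_of_le_of_lt ?_ hk⟩
  exact hw.natCast_mul_le_lorentz hdec hq hr hc hN
    (ofReal_le_hardyOp hga.coe_nnreal_ennreal hr hc hcg)

theorem aemeasurable_hardyOp_weightMeasure (w : ℝ → ℝ≥0) {g : ℝ → ℝ≥0∞}
    (hg : AntitoneOn g (Ioi 0)) : AEMeasurable (hardyOp g) (weightMeasure w) :=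
  (hardyOp_antitoneOn hg).aemeasurable_restrict_Ioi.mono_ac
    (withDensity_absolutelyContinuous _ _)

theorem IsWeight.weightedLorentzNorm_hardyOp_le (hw : IsWeight w) (hq : 1 < q) {g : ℝ → ℝ≥0∞}
    (hg : AntitoneOn g (Ioi 0)) :
    weightedLorentzNorm 1 q w (hardyOp g) ≤ weightedLpNorm 1 w (hardyOp g) := by
  refine (weightedLorentzNorm_le hq (aemeasurable_hardyOp_weightMeasure w hg)).trans ?_
  rw [hw.lintegral_weightMeasure (hardyOp_antitoneOn hg).aemeasurable_restrict_Ioi,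
    weightedLpNorm_one]

theorem IsWeight.gammaNorm_le {n : ℕ} (hw : IsWeight w) (hdec : AntitoneOn w (Ioi 0)) (hq : 1 < q)
    {C : ℝ≥0} (hC : ∀ f ∈ LpDec 1 w, weightedLpNorm 1 w (hardyOp (fun t => (f t : ℝ≥0∞)))
      ≤ C * weightedLpNorm 1 w (fun t => (f t : ℝ≥0∞)))
    {f : EuclideanSpace ℝ (Fin n) → ℝ≥0} (hf : f ∈ LambdaSpace n 1 w) :
    gammaNorm 1 q w f ≤ C * lambdaNorm 1 w f := by
  have hq0 : 0 < q := by linarith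
  have hfa : AntitoneOn (fStar f) (Ioi 0) := (fStar_antitone f).antitoneOn _
  have hl : lambdaNorm 1 w f = ∫⁻ t in Ioi (0 : ℝ), fStar f t * (w t : ℝ≥0∞) := by
    simp [lambdaNorm]
  have hint := hf.2
  rw [hl] at hint
  have hS : gammaNorm 1 q w f ≤ weightedLpNorm 1 w (hardyOp (fStar f)) := by
    rw [gammaNorm, one_div q, ENNReal.rpow_inv_le_iff hq0, weightedLpNorm_one]
    exact lintegral_hardyOp_rpow_le hq hw hfa
  refine hS.trans ?_
  -- For the zero weight `f^*` may be infinite, so the finite-valued cone is unavailable, but the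
  -- left side vanishes.
  by_cases hz : ∀ t, 0 < t → w t = 0
  · rw [weightedLpNorm_one, setLIntegral_congr_fun (g := fun _ => 0) measurableSet_Ioi]
    · simp
    · intro t ht
      simp [hz t ht]
  push Not at hz
  obtain ⟨t₀, ht₀, hwt⟩ := hz
  have hfin : ∀ t, 0 < t → fStar f t ≠ ∞ := fun t ht =>
    (lt_top_of_lintegral_mul_lt_top hdec ht₀ hwt hfa hint ht).ne
  have hcoe : ∀ t, 0 < t → (((fStar f t).toNNReal : ℝ≥0) : ℝ≥0∞) = fStar f t := fun t ht =>
    ENNReal.coe_toNNReal (hfin t ht)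
  have hnorm : weightedLpNorm 1 w (fun t => ((fStar f t).toNNReal : ℝ≥0∞)) = lambdaNorm 1 w f := by
    rw [weightedLpNorm_one, hl]
    refine setLIntegral_congr_fun measurableSet_Ioi fun t ht => ?_
    simp only [hcoe t ht]
  have := hC (fun t => (fStar f t).toNNReal)
    ⟨fun s hs t ht hst => ENNReal.toNNReal_mono (hfin s hs) (hfa hs ht hst), by
      rw [hnorm]; exact hf.2⟩
  rwa [hnorm, hardyOp_congr hcoe] at this

theorem mainTheorem3 (n : ℕ) (hn : 1 ≤ n) (q : ℝ) (hq : 1 < q)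
    (w : ℝ → ℝ≥0) (hw : IsWeight w) (hdec : AntitoneOn w (Ioi 0)) :
    List.TFAE [
      -- the inclusion of the spaces, as sets and with a norm estimate
      LambdaSpace n 1 w ⊆ GammaSpace n 1 q w,
      ∃ C : ℝ≥0, ∀ f ∈ LambdaSpace n 1 w, gammaNorm 1 q w f ≤ C * lambdaNorm 1 w f,
      -- the Hardy operator from the decreasing cone of L^1(w) to L^{1,q}(w),
      -- as a mapping property and with a norm estimate
      ∀ f ∈ LpDec 1 w, hardyOp (fun t => (f t : ℝ≥0∞)) ∈ WeightedLorentz 1 q w,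
      ∃ C : ℝ≥0, ∀ f ∈ LpDec 1 w,
        weightedLorentzNorm 1 q w (hardyOp (fun t => (f t : ℝ≥0∞)))
          ≤ C * weightedLpNorm 1 w (fun t => (f t : ℝ≥0∞)),
      -- the condition on the weight
      BClass 1 w,
      -- the strong type (1,1) Hardy inequality
      ∃ C : ℝ≥0, ∀ f ∈ LpDec 1 w,
        weightedLpNorm 1 w (hardyOp (fun t => (f t : ℝ≥0∞)))
          ≤ C * weightedLpNorm 1 w (fun t => (f t : ℝ≥0∞))] := by
  tfae_have 1 → 5 := bClass_one_of_subset hn hq hw hdec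
  tfae_have 3 → 5 := bClass_one_of_mem_weightedLorentz hq hw hdec
  tfae_have 5 → 6 := by
    intro hB
    obtain ⟨C, hC⟩ := hB.lintegral_hardyOp_le hw
    refine ⟨C, fun f hf => ?_⟩
    rw [weightedLpNorm_one, weightedLpNorm_one]
    exact hC _ hf.1.coe_nnreal_ennreal
  tfae_have 6 → 2 := fun ⟨C, hC⟩ => ⟨C, fun f hf => hw.gammaNorm_le hdec hq hC hf⟩
  tfae_have 6 → 4 := fun ⟨C, hC⟩ => ⟨C, fun f hf =>
    (hw.weightedLorentzNorm_hardyOp_le hq hf.1.coe_nnreal_ennreal).trans (hC f hf)⟩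
  tfae_have 2 → 1 := fun ⟨C, hC⟩ f hf =>
    ⟨hf.1, (hC f hf).trans_lt (ENNReal.mul_lt_top ENNReal.coe_lt_top hf.2)⟩
  tfae_have 4 → 3 := fun ⟨C, hC⟩ f hf =>
    ⟨aemeasurable_hardyOp_weightMeasure w hf.1.coe_nnreal_ennreal,
      (hC f hf).trans_lt (ENNReal.mul_lt_top ENNReal.coe_lt_top hf.2)⟩
  tfae_finish
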